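/- All vector spaces are over $\mathbb{C}$. For a vector space $W$ and $r\ge 1$, $W((x_1,\dots,x_r))=W[[x_1,\dots,x_r]][x_1^{-1},\dots,x_r^{-1}]$. Let $\Gamma$ be a group. A *vertex $\Gamma$-algebra* is a vertex algebra $(V,Y,\mathbf 1)$, with $Y(v,x)=\sum_{n\in\mathbb Z}v_nx^{-n-1}$, together with group homomorphisms $R:\Gamma\to \mathrm{GL}(V)$ and $\phi:\Gamma\to\mathbb{C}^\times$ such that $R_g\mathbf 1=\mathbf 1$ and $R_gY(v,x)=Y(R_gv,\phi(g)^{-1}x)R_g$ for all $g\in\Gamma$, $v\in V$. A *$\Gamma$-equivariant quasi $V$-module* is a vector space $W$ with a linear map $Y_W(\cdot,x):V\to \mathrm{Hom}(W,W((x)))$ such that $Y_W(\mathbf 1,x)=1_W$, $Y_W(R_gv,x)=Y_W(v,\phi(g)x)$ for all $g\in\Gamma$, $v\in V$, and such that for all $u,v\in V$ there are $k\ge 0$ and $g_1,\dots,g_k\in\Gamma$ (not necessarily distinct) such that, with $p(x_1,x_2)=\prod_{i=1}^k(x_1-\phi(g_i)x_2)$, $$x_0^{-1}\delta\!\left(\tfrac{x_1-x_2}{x_0}\right)p(x_1,x_2)Y_W(u,x_1)Y_W(v,x_2)-x_0^{-1}\delta\!\left(\tfrac{x_2-x_1}{-x_0}\right)p(x_1,x_2)Y_W(v,x_2)Y_W(u,x_1)=x_2^{-1}\delta\!\left(\tfrac{x_1-x_0}{x_2}\right)p(x_1,x_2)Y_W(Y(u,x_0)v,x_2).$$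 **Proposition.** Let $V$ be a vertex $\Gamma$-algebra, let $a\in V$ be such that $a_na=0$ for all $n\ge 0$, and let $(W,Y_W)$ be a $\Gamma$-equivariant quasi $V$-module. Then there exists a polynomial $q(z)\in\mathbb{C}[z]$ with $q(1)=1$ such that $$q(x_1/x)\,Y_W(a,x_1)Y_W(a,x)=q(x_1/x)\,Y_W(a,x)Y_W(a,x_1).\qquad(*)$$ Furthermore, let $q(z)$ be any polynomial with $q(1)=1$ satisfying $(*)$, let $\ell$ be any positive integer, and set $$F(x_1,\dots,x_{\ell+1})=\Big(\prod_{1\le i<j\le \ell+1}q(x_i/x_j)\Big)Y_W(a,x_1)\cdots Y_W(a,x_{\ell+1}).$$ Then $F\in \mathrm{Hom}(W,W((x_1,\dots,x_{\ell+1})))$, so that the substitution $x_1=\cdots=x_{\ell+1}=x$ in $F$ makes sense, and $$Y_W\big((a_{-1})^{\ell+1}\mathbf 1,x\big)=F(x_1,\dots,x_{\ell+1})\big|_{x_1=\cdots=x_{\ell+1}=x}.$$ Consequently, if $(a_{-1})^{\ell+1}\mathbf 1=0$ in $V$, then $F|_{x_1=\cdots=x_{\ell+1}=x}=0$; conversely,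 if $F|_{x_1=\cdots=x_{\ell+1}=x}=0$ and $W$ is faithful (that is, $v\mapsto Y_W(v,x)$ is injective), then $(a_{-1})^{\ell+1}\mathbf 1=0$. -/

import Mathlib

noncomputable section

namespace VertexTheory

/-! ### Formal series in several variables -/

/-- `M[[x₁^{±1}, …, x_r^{±1}]]`: `A e` is the coefficient of `x^e = x₁^{e₁} ⋯ x_r^{e_r}`
(the variables are indexed by `Fin r`, so they are numbered from `0`). -/
abbrev FormalSeries (r : ℕ) (M : Type*) := (Fin r → ℤ) → M

/-- The ring `ℂ[x₁^{±1}, …, x_r^{±1}]` of Laurent polynomials. -/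
abbrev LaurentPoly (r : ℕ) := AddMonoidAlgebra ℂ (Fin r → ℤ)

/-- The Laurent monomial `x^e`. -/
def monom {r : ℕ} (e : Fin r → ℤ) : LaurentPoly r := AddMonoidAlgebra.single e 1

/-- A polynomial in `x₁, x₂` as a Laurent polynomial. -/
def ofPoly (p : MvPolynomial (Fin 2) ℂ) : LaurentPoly 2 :=
  MvPolynomial.aeval (fun i => monom (Pi.single i (1 : ℤ))) p

/-- `q(x_i / x_j)`, a Laurent polynomial, for a polynomial `q(z)`. -/
def ratioEval {r : ℕ} (q : Polynomial ℂ) (i j : Fin r) : LaurentPoly r :=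
  Polynomial.aeval (monom (Pi.single i (1 : ℤ) - Pi.single j (1 : ℤ))) q

/-- The product `f · A` of a Laurent polynomial and a formal series. -/
def lmul {r : ℕ} {M : Type*} [AddCommGroup M] [Module ℂ M]
    (f : LaurentPoly r) (A : FormalSeries r M) : FormalSeries r M :=
  fun e => f.coeff.sum fun k c => c • A (e - k)

section Operators

variable {W : Type*} [AddCommGroup W] [Module ℂ W]

/-- `F ∈ Hom(W, W((x₁, …, x_r)))`: for every `w`, the series `F w` involves only exponents that
are bounded below, in each of the variables. -/
def IsLowerTruncated {r : ℕ} (F : FormalSeries r (Module.End ℂ W)) : Prop :=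
  ∀ w : W, ∃ N : ℤ, ∀ e : Fin r → ℤ, (∃ i, e i < N) → F e w = 0

/-- The coefficient of `x^m` in `F w |_{x₁ = ⋯ = x_r = x}`. The substitution is meaningful for
`F ∈ Hom(W, W((x₁, …, x_r)))`; the sum is then finite. -/
def diagCoeff {r : ℕ} (F : FormalSeries r (Module.End ℂ W)) (m : ℤ) (w : W) : W :=
  ∑ᶠ (e : Fin r → ℤ) (_ : ∑ i, e i = m), F e w

/-- `A(x₁) A(x₂) ⋯ A(x_r)` for `A(x) ∈ Hom(W, W((x)))`. -/
def powerProduct (r : ℕ) (A : VertexOperator ℂ W) : FormalSeries r (Module.End ℂ W) :=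
  fun e => (List.ofFn fun i => HVertexOperator.coeff A (e i)).prod

/-- `q(x₁/x) A(x₁) A(x) = q(x₁/x) A(x) A(x₁)`; here `x₁`, `x` have the indices `0`, `1`. -/
def SelfCommutesAfter (q : Polynomial ℂ) (A : VertexOperator ℂ W) : Prop :=
  lmul (ratioEval q (0 : Fin 2) 1)
      (fun e => HVertexOperator.coeff A (e 0) * HVertexOperator.coeff A (e 1)) =
    lmul (ratioEval q (0 : Fin 2) 1)
      (fun e => HVertexOperator.coeff A (e 1) * HVertexOperator.coeff A (e 0))

/-- `∏_{i < j} q(x_i / x_j) · A(x₁) ⋯ A(x_r)`. -/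
def regularizedProduct (q : Polynomial ℂ) (r : ℕ) (A : VertexOperator ℂ W) :
    FormalSeries r (Module.End ℂ W) :=
  lmul (∏ i : Fin r, ∏ j ∈ Finset.Ioi i, ratioEval q i j) (powerProduct r A)

end Operators

/-! ### The (quasi) Jacobi identity -/

section Jacobi

variable {V W : Type*} [AddCommGroup V] [Module ℂ V] [AddCommGroup W] [Module ℂ W]

/-- The coefficient of `x₀^{-n-1}` in `x₀⁻¹ δ((x₁ - x₂)/x₀) A(x₁) B(x₂) w`, that is,
`(x₁ - x₂)^n A(x₁) B(x₂) w` with `(x₁ - x₂)^n` expanded in nonnegative powers of `x₂`. -/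
def jacobiLeft (A B : VertexOperator ℂ W) (n : ℤ) (w : W) : FormalSeries 2 W :=
  fun e => ∑ᶠ i : ℕ, ((-1 : ℂ) ^ i * (Ring.choose n i : ℤ)) •
    HVertexOperator.coeff A (e 0 - (n - i)) (HVertexOperator.coeff B (e 1 - i) w)

/-- The coefficient of `x₀^{-n-1}` in `x₀⁻¹ δ((x₂ - x₁)/(-x₀)) B(x₂) A(x₁) w`, that is,
`(-x₂ + x₁)^n B(x₂) A(x₁) w` with `(-x₂ + x₁)^n` expanded in nonnegative powers of `x₁`. -/
def jacobiMiddle (A B : VertexOperator ℂ W) (n : ℤ) (w : W) : FormalSeries 2 W :=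
  fun e => ∑ᶠ i : ℕ, ((-1 : ℂ) ^ n * (-1 : ℂ) ^ i * (Ring.choose n i : ℤ)) •
    HVertexOperator.coeff B (e 1 - (n - i)) (HVertexOperator.coeff A (e 0 - i) w)

/-- The coefficient of `x₀^{-n-1}` in `x₂⁻¹ δ((x₁ - x₀)/x₂) Y_W(Y(u, x₀) v, x₂) w`, where
`x₂⁻¹ δ((x₁ - x₀)/x₂) = ∑_{m ∈ ℤ} ∑_{i ≥ 0} (-1)^i (m choose i) x₁^{m-i} x₀^i x₂^{-m-1}`;
in the coefficient of `x₁^{e₁}` only `m = e₁ + i` contributes. -/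
def jacobiRight (Y : V →ₗ[ℂ] VertexOperator ℂ V) (YW : V →ₗ[ℂ] VertexOperator ℂ W)
    (u v : V) (n : ℤ) (w : W) : FormalSeries 2 W :=
  fun e => ∑ᶠ i : ℕ, ((-1 : ℂ) ^ i * (Ring.choose (e 0 + i) i : ℤ)) •
    HVertexOperator.coeff (YW (VertexOperator.ncoeff (Y u) (n + i) v)) (e 1 + (e 0 + i) + 1) w

/-- The Jacobi identity for `u, v`, multiplied by `p(x₁, x₂)`; it is stated for every vector `w`
and for the coefficient of every power `x₀^{-n-1}` of `x₀`. All sums involved are finite. -/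
def QuasiJacobi (Y : V →ₗ[ℂ] VertexOperator ℂ V) (YW : V →ₗ[ℂ] VertexOperator ℂ W)
    (p : MvPolynomial (Fin 2) ℂ) (u v : V) : Prop :=
  ∀ (n : ℤ) (w : W),
    lmul (ofPoly p) (jacobiLeft (YW u) (YW v) n w) -
        lmul (ofPoly p) (jacobiMiddle (YW u) (YW v) n w) =
      lmul (ofPoly p) (jacobiRight Y YW u v n w)

end Jacobi

/-! ### Vertex algebras and their quasi modules -/

/-- The structure of a vertex algebra on a complex vector space `V`. Lower truncation
(`u_n v = 0` for `n` large) is part of `Y(u, x) ∈ Hom(V, V((x)))`. -/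
structure VertexAlgebra (V : Type*) [AddCommGroup V] [Module ℂ V] where
  /-- the vertex operator map `v ↦ Y(v, x)` -/
  Y : V →ₗ[ℂ] VertexOperator ℂ V
  /-- the vacuum vector `𝟏` -/
  vac : V
  /-- `Y(𝟏, x) = 1` -/
  vacuum : ∀ n : ℤ, HVertexOperator.coeff (Y vac) n = if n = 0 then 1 else 0
  /-- `Y(v, x)𝟏` has no negative powers of `x` -/
  creation_neg : ∀ (v : V) (n : ℤ), n < 0 → HVertexOperator.coeff (Y v) n vac = 0
  /-- `Y(v, x)𝟏` has constant term `v` -/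
  creation_zero : ∀ v : V, HVertexOperator.coeff (Y v) 0 vac = v
  /-- the Jacobi identity -/
  jacobi : ∀ u v : V, QuasiJacobi Y Y 1 u v

/-- The mode `u_n`, where `Y(u, x) = ∑ u_n x^{-n-1}`. -/
def VertexAlgebra.mode {V : Type*} [AddCommGroup V] [Module ℂ V] (A : VertexAlgebra V)
    (u : V) (n : ℤ) : Module.End ℂ V :=
  VertexOperator.ncoeff (A.Y u) n

/-- A quasi module structure on `W` for a vertex algebra. -/
structure QuasiModule {V : Type*} [AddCommGroup V] [Module ℂ V] (A : VertexAlgebra V)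
    (W : Type*) [AddCommGroup W] [Module ℂ W] where
  /-- the map `v ↦ Y_W(v, x)` -/
  Y : V →ₗ[ℂ] VertexOperator ℂ W
  /-- `Y_W(𝟏, x) = 1` -/
  vacuum : ∀ n : ℤ, HVertexOperator.coeff (Y A.vac) n = if n = 0 then 1 else 0
  /-- the quasi Jacobi identity -/
  quasi_jacobi : ∀ u v : V, ∃ p : MvPolynomial (Fin 2) ℂ, p ≠ 0 ∧ QuasiJacobi A.Y Y p u v

/-- The structure of a vertex `Γ`-algebra on `V`. -/
structure VertexGroupAlgebra (Γ : Type*) [Group Γ] (V : Type*) [AddCommGroup V] [Module ℂ V]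
    extends VertexAlgebra V where
  /-- the homomorphism `R : Γ → GL(V)` -/
  R : Γ →* (V ≃ₗ[ℂ] V)
  /-- the linear character `φ : Γ → ℂˣ` -/
  φ : Γ →* ℂˣ
  R_vac : ∀ g : Γ, R g vac = vac
  /-- `R_g Y(v, x) = Y(R_g v, φ(g)⁻¹ x) R_g` -/
  R_Y : ∀ (g : Γ) (v w : V) (n : ℤ),
    R g (HVertexOperator.coeff (Y v) n w) =
      (((φ g)⁻¹ : ℂˣ) : ℂ) ^ n • HVertexOperator.coeff (Y (R g v)) n (R g w)

/-- A `Γ`-equivariant quasi module structure on `W` for a vertex `Γ`-algebra. -/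
structure EquivariantQuasiModule {Γ : Type*} [Group Γ] {V : Type*} [AddCommGroup V] [Module ℂ V]
    (A : VertexGroupAlgebra Γ V) (W : Type*) [AddCommGroup W] [Module ℂ W]
    extends QuasiModule A.toVertexAlgebra W where
  /-- `Y_W(R_g v, x) = Y_W(v, φ(g) x)` -/
  equivariant : ∀ (g : Γ) (v : V) (n : ℤ),
    HVertexOperator.coeff (Y (A.R g v)) n = (A.φ g : ℂ) ^ n • HVertexOperator.coeff (Y v) n
  /-- the quasi Jacobi identity holds with some `p = (x₁ - φ(g₁) x₂) ⋯ (x₁ - φ(g_k) x₂)` -/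
  equivariant_jacobi : ∀ u v : V, ∃ l : List Γ,
    QuasiJacobi A.Y Y
      (l.map fun g => MvPolynomial.X 0 - MvPolynomial.C (A.φ g : ℂ) * MvPolynomial.X 1).prod u v

end VertexTheory

end

/-! Multiplication by `x₁ - x₂` sends the `n`-th component of each of the three Jacobi terms to the
`(n+1)`-st. As `n` ranges over all integers, factors `x₁ - x₂` of the local polynomial can be
cancelled. The other factors are `x₂ (x₁/x₂ - c)` with `c ≠ 1`, so up to a monomial and a scalar
there remains `p(x₁/x₂)` with `p(1) = 1` (`exists_ratioEval_jacobi`).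

If `u_n v = 0` for `n ≥ 0`, component `0` says that `Y_W(u, x₁)` and `Y_W(v, x₂)` commute after
multiplication by `p(x₁/x₂)`. Component `-1` has a delta function on the right; multiplying it by
`x₁ - x₂` makes the diagonal sum telescope to `Y_W(u_{-1} v, x)` (`substAlong_act_ratioEval`).

For powers of `a_{-1}`, induct on the number `r` of factors, with `b = (a_{-1})^r 𝟏`. Setting all
variables but the first equal turns the product of `r + 1` factors into `q(x₀/x₂)^r Y_W(a, x₀)
Y_W(b, x₂)` (`substAlong_partialDegree`). The pair `a, b` has its own `p`, unrelated to `q`, but `p`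
and `q^r` both become `1` on the diagonal, so multiplying by both shows that they give the same
value (`coeff_pow_vac`). All substitutions are legitimate by `boundedBelowAt_regularizedProduct`. -/

namespace VertexTheory

open Finset

/-! ### Formal series: substitution of variables and the action of Laurent polynomials -/

section Series

variable {E E' E'' M : Type*} [AddCommGroup E] [AddCommGroup E'] [AddCommGroup E'']
  [AddCommGroup M]

/-- A series is summable along `π` if each fibre of `π` contains only finitely many exponents of
it. -/
def SummableAlong (π : E →+ E') (F : E → M) : Prop :=
  ∀ y, {e | π e = y ∧ F e ≠ 0}.Finite

/-- The substitution of variables corresponding to a homomorphism `π` of exponent groups. -/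
noncomputable def substAlong (π : E →+ E') (F : E → M) : E' → M :=
  fun y => ∑ᶠ (e : E) (_ : π e = y), F e

lemma SummableAlong.zero (π : E →+ E') : SummableAlong π (0 : E → M) := fun y => by simp

lemma SummableAlong.add {π : E →+ E'} {F G : E → M} (hF : SummableAlong π F)
    (hG : SummableAlong π G) : SummableAlong π (F + G) := fun y =>
  ((hF y).union (hG y)).subset fun e ⟨h, h'⟩ => by
    by_contra hn
    simp only [Set.mem_union, Set.mem_ofPred_eq, h, true_and, not_or, not_not] at hn
    exact h' (by simp [hn.1, hn.2])

lemma substAlong_eq_sum {π : E →+ E'} {F : E → M} {y : E'} {s : Finset E}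
    (h₁ : ∀ e ∈ s, π e = y) (h₂ : ∀ e, π e = y → F e ≠ 0 → e ∈ s) :
    substAlong π F y = ∑ e ∈ s, F e := by
  classical
  change ∑ᶠ e ∈ {e | π e = y}, F e = _
  rw [finsum_mem_def, finsum_eq_sum_of_support_subset (s := s)]
  · refine Finset.sum_congr rfl fun e he => ?_
    exact Set.indicator_of_mem (show e ∈ {e | π e = y} from h₁ e he) F
  · intro e he
    rw [Function.mem_support, Set.indicator_apply] at he
    split_ifs at he with h
    · exact h₂ e h he
    · exact absurd rfl he

lemma substAlong_add {π : E →+ E'} {F G : E → M} (hF : SummableAlong π F)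
    (hG : SummableAlong π G) : substAlong π (F + G) = substAlong π F + substAlong π G := by
  classical
  funext y
  set s := (hF y).toFinset ∪ (hG y).toFinset
  have h₁ : ∀ e ∈ s, π e = y := by
    intro e he
    simp only [s, Finset.mem_union, Set.Finite.mem_toFinset, Set.mem_ofPred_eq] at he
    tauto
  have hFs : ∀ e, π e = y → F e ≠ 0 → e ∈ s := fun e h h' => by simp [s, h, h']
  have hGs : ∀ e, π e = y → G e ≠ 0 → e ∈ s := fun e h h' => by simp [s, h, h']
  rw [Pi.add_apply, substAlong_eq_sum h₁ hFs, substAlong_eq_sum h₁ hGs,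
    substAlong_eq_sum (s := s) h₁, ← Finset.sum_add_distrib]
  · rfl
  · intro e h h'
    by_contra hn
    refine h' ?_
    rw [Pi.add_apply, not_imp_comm.1 (hFs e h) hn, not_imp_comm.1 (hGs e h) hn, add_zero]

lemma exists_ne_zero_of_substAlong_ne_zero {π : E →+ E'} {F : E → M} {y : E'}
    (h : substAlong π F y ≠ 0) : ∃ e, π e = y ∧ F e ≠ 0 := by
  by_contra! hn
  exact h (finsum_mem_eq_zero_of_forall_eq_zero hn)

lemma SummableAlong.substAlong {π : E →+ E'} {ρ : E' →+ E''} {F : E → M}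
    (hF : SummableAlong (ρ.comp π) F) : SummableAlong ρ (substAlong π F) := fun y =>
  ((hF y).image π).subset fun z ⟨h, h'⟩ => by
    obtain ⟨e, he, he'⟩ := exists_ne_zero_of_substAlong_ne_zero h'
    exact ⟨e, ⟨by simp [he, h], he'⟩, he⟩

/-- Each fibre of `π` lies in a fibre of `ρ.comp π`, so summability along the composite suffices:
the finite sum over a fibre of the composite is regrouped by the value of `π`. -/
lemma substAlong_substAlong {π : E →+ E'} {ρ : E' →+ E''} {F : E → M}
    (hF : SummableAlong (ρ.comp π) F) :
    substAlong ρ (substAlong π F) = substAlong (ρ.comp π) F := by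
  classical
  funext y
  rw [substAlong_eq_sum (s := (hF y).toFinset) (π := ρ.comp π) (F := F),
    substAlong_eq_sum (s := (hF y).toFinset.image π),
    ← Finset.sum_fiberwise_of_maps_to (t := (hF y).toFinset.image π) (g := π)
      (fun e he => Finset.mem_image_of_mem _ he)]
  · refine Finset.sum_congr rfl fun z hz => ?_
    have hz' : ρ z = y := by
      obtain ⟨e, he, rfl⟩ := Finset.mem_image.1 hz
      exact ((hF y).mem_toFinset.1 he).1
    refine substAlong_eq_sum (fun e he => (Finset.mem_filter.1 he).2) fun e h h' => ?_
    exact Finset.mem_filter.2 ⟨(hF y).mem_toFinset.2 ⟨by simp [h, hz'], h'⟩, h⟩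
  · intro z hz
    obtain ⟨e, he, rfl⟩ := Finset.mem_image.1 hz
    exact ((hF y).mem_toFinset.1 he).1
  · intro z h h'
    obtain ⟨e, he, he'⟩ := exists_ne_zero_of_substAlong_ne_zero h'
    exact Finset.mem_image.2 ⟨e, (hF y).mem_toFinset.2 ⟨by simp [he, h], he'⟩, he⟩
  · intro e he
    exact ((hF y).mem_toFinset.1 he).1
  · intro e h h'
    exact (hF y).mem_toFinset.2 ⟨h, h'⟩

/-- The exponents of the `i`-th variable in `F` are bounded below. -/
def BoundedBelowAt {r : ℕ} (i : Fin r) (F : FormalSeries r M) : Prop :=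
  ∃ N : ℤ, ∀ e, e i < N → F e = 0

/-- The total degree `(Fin r → ℤ) → ℤ`. -/
def totalDegree (r : ℕ) : (Fin r → ℤ) →+ ℤ where
  toFun e := ∑ i, e i
  map_zero' := by simp
  map_add' _ _ := by simp [Finset.sum_add_distrib]

lemma totalDegree_apply {r : ℕ} (e : Fin r → ℤ) : totalDegree r e = ∑ i, e i := rfl

lemma exists_common_lower_bound {r : ℕ} {F : FormalSeries r M} (hF : ∀ i, BoundedBelowAt i F) :
    ∃ N : ℤ, ∀ e, (∃ i, e i < N) → F e = 0 := by
  choose N hN using hF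
  obtain ⟨N₀, h₀⟩ := (Set.finite_range N).bddBelow
  exact ⟨N₀, fun e ⟨i, hi⟩ => hN i e (lt_of_lt_of_le hi (h₀ ⟨i, rfl⟩))⟩

lemma summableAlong_totalDegree {r : ℕ} {F : FormalSeries r M} (hF : ∀ i, BoundedBelowAt i F) :
    SummableAlong (totalDegree r) F := by
  obtain ⟨N, hN⟩ := exists_common_lower_bound hF
  intro y
  -- The numbers `e i - N` are nonnegative with sum `y - r * N`, which bounds each of them.
  refine (Set.finite_Icc (fun _ => N) (fun _ : Fin r => y - r * N + N)).subset fun e ⟨h, h'⟩ => ?_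
  have hge : ∀ i, N ≤ e i := fun i => by
    by_contra hlt
    exact h' (hN e ⟨i, not_le.1 hlt⟩)
  refine ⟨hge, fun i => ?_⟩
  have h1 : e i - N ≤ ∑ j, (e j - N) :=
    Finset.single_le_sum (f := fun j => e j - N) (fun j _ => sub_nonneg.2 (hge j))
      (Finset.mem_univ i)
  rw [Finset.sum_sub_distrib, ← totalDegree_apply, h] at h1
  simp at h1
  simp only
  linarith

variable [Module ℂ M]

/-- Multiplication by `x^k` on formal series with exponents in `E`. -/
def shift (E M : Type*) [AddCommGroup E] [AddCommGroup M] [Module ℂ M] :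
    Multiplicative E →* Module.End ℂ (E → M) where
  toFun k :=
    { toFun := fun F e => F (e - k.toAdd)
      map_add' := fun _ _ => rfl
      map_smul' := fun _ _ => rfl }
  map_one' := by ext F e; simp
  map_mul' k l := by
    refine LinearMap.ext fun F => funext fun e => ?_
    simp only [LinearMap.coe_mk, AddHom.coe_mk, Module.End.mul_apply, toAdd_mul]
    congr 1; abel

/-- The action of the group algebra of `E` on formal series with exponents in `E`. -/
noncomputable def act (E M : Type*) [AddCommGroup E] [AddCommGroup M] [Module ℂ M] :
    AddMonoidAlgebra ℂ E →ₐ[ℂ] Module.End ℂ (E → M) :=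
  AddMonoidAlgebra.lift ℂ (Module.End ℂ (E → M)) E (shift E M)

lemma act_single (k : E) (c : ℂ) (F : E → M) (e : E) :
    act E M (AddMonoidAlgebra.single k c) F e = c • F (e - k) := by
  rw [act, AddMonoidAlgebra.lift_single]; rfl

/-- Since `act` is an algebra homomorphism, products of Laurent polynomials become compositions and
can be reordered freely. -/
lemma lmul_eq_act {r : ℕ} (f : LaurentPoly r) (F : FormalSeries r M) :
    lmul f F = act (Fin r → ℤ) M f F := by
  funext e
  rw [act, AddMonoidAlgebra.lift_apply]
  simp only [lmul, Finsupp.sum, LinearMap.sum_apply, Finset.sum_apply]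
  rfl

lemma act_induction {P : (E → M) → Prop} (zero : P 0) (add : ∀ F G, P F → P G → P (F + G))
    (shift : ∀ (k : E) (c : ℂ) F, P F → P fun e => c • F (e - k))
    (f : AddMonoidAlgebra ℂ E) {F : E → M} (hF : P F) : P (act E M f F) := by
  induction f using AddMonoidAlgebra.induction_linear with
  | zero => simpa using zero
  | add f g hf hg => simpa using add _ _ hf hg
  | single k c =>
    have : act E M (AddMonoidAlgebra.single k c) F = fun e => c • F (e - k) :=
      funext (act_single k c F)
    rw [this]; exact shift k c F hF

lemma act_single_injective (k : E) {c : ℂ} (hc : c ≠ 0) :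
    Function.Injective (act E M (AddMonoidAlgebra.single k c)) := by
  intro F G h
  funext e
  have := congrFun h (e + k)
  simpa [act_single, hc] using this

/-- Multiplication of series is natural for a linear map between the coefficients which is
compatible with a translation-equivariant change of exponents. -/
lemma act_natural {N : Type*} [AddCommGroup N] [Module ℂ N] (ι : E →+ E') (T : M →ₗ[ℂ] N)
    (j : E' → E) (f : AddMonoidAlgebra ℂ E)
    (F : E → M) (H : E' → N) (e' : E') (hH : ∀ k, H (e' - ι k) = T (F (j e' - k))) :
    act E' N (AddMonoidAlgebra.mapDomainAlgHom ℂ ℂ ι f) H e' = T (act E M f F (j e')) := by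
  induction f using AddMonoidAlgebra.induction_linear with
  | zero => simp
  | add f g hf hg => simp only [map_add, LinearMap.add_apply, Pi.add_apply, hf, hg]
  | single k c =>
    simp [AddMonoidAlgebra.mapDomainAlgHom, act_single, hH]

lemma SummableAlong.shift {π : E →+ E'} {F : E → M} (k : E) (c : ℂ) (hF : SummableAlong π F) :
    SummableAlong π fun e => c • F (e - k) := fun y =>
  ((hF (y - π k)).preimage (sub_left_injective (b := k)).injOn).subset fun e ⟨h, h'⟩ =>
    ⟨by rw [map_sub, h], fun h0 => h' (by simp [h0])⟩

lemma SummableAlong.act {π : E →+ E'} {F : E → M} (f : AddMonoidAlgebra ℂ E)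
    (hF : SummableAlong π F) : SummableAlong π (act E M f F) :=
  act_induction (.zero π) (fun _ _ => .add) (fun k c _ => .shift k c) f hF

/-- By linearity only monomials matter; translation by `k` carries the fibre over `y - π k` onto the
fibre over `y`. -/
lemma substAlong_act {π : E →+ E'} {F : E → M} (f : AddMonoidAlgebra ℂ E)
    (hF : SummableAlong π F) :
    substAlong π (act E M f F) =
      act E' M (AddMonoidAlgebra.mapDomainAlgHom ℂ ℂ π f) (substAlong π F) := by
  classical
  induction f using AddMonoidAlgebra.induction_linear with
  | zero =>
    funext y
    simp [substAlong]
  | add f g hf hg =>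
    simp only [map_add, LinearMap.add_apply]
    rw [substAlong_add (hF.act f) (hF.act g), hf, hg]
  | single k c =>
    funext y
    have hs : AddMonoidAlgebra.mapDomainAlgHom ℂ ℂ π (AddMonoidAlgebra.single k c) =
        AddMonoidAlgebra.single (π k) c := by simp [AddMonoidAlgebra.mapDomainAlgHom]
    rw [hs, act_single, substAlong_eq_sum (s := (hF (y - π k)).toFinset) (F := F),
      substAlong_eq_sum (s := (hF (y - π k)).toFinset.map (Equiv.addRight k).toEmbedding),
      Finset.sum_map, Finset.smul_sum]
    · simp [act_single]
    · intro e he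
      simp only [Finset.mem_map, Set.Finite.mem_toFinset, Set.mem_ofPred_eq] at he
      obtain ⟨a, ⟨ha, -⟩, rfl⟩ := he
      simp [ha]
    · intro e h h'
      rw [act_single] at h'
      simp only [Finset.mem_map, Set.Finite.mem_toFinset, Set.mem_ofPred_eq]
      exact ⟨e - k, ⟨by rw [map_sub, h], fun h0 => h' (by simp [h0])⟩, by simp⟩
    · intro e he
      exact ((hF _).mem_toFinset.1 he).1
    · intro e h h'
      exact (hF _).mem_toFinset.2 ⟨h, h'⟩

lemma BoundedBelowAt.act {r : ℕ} {i : Fin r} {F : FormalSeries r M} (f : LaurentPoly r)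
    (hF : BoundedBelowAt i F) : BoundedBelowAt i (act (Fin r → ℤ) M f F) := by
  refine act_induction ⟨0, fun _ _ => rfl⟩ ?_ ?_ f hF
  · rintro F G ⟨N, hN⟩ ⟨N', hN'⟩
    refine ⟨min N N', fun e he => ?_⟩
    rw [Pi.add_apply, hN e (lt_of_lt_of_le he (min_le_left _ _)),
      hN' e (lt_of_lt_of_le he (min_le_right _ _)), add_zero]
  · rintro k c F ⟨N, hN⟩
    refine ⟨N + k i, fun e he => ?_⟩
    have : F (e - k) = 0 := hN _ (by rw [Pi.sub_apply]; omega)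
    simp only [this, smul_zero]

lemma mapDomainAlgHom_ratioEval {r : ℕ} (π : (Fin r → ℤ) →+ E') (q : Polynomial ℂ)
    (i j : Fin r) :
    AddMonoidAlgebra.mapDomainAlgHom ℂ ℂ π (ratioEval q i j) =
      Polynomial.aeval
        (AddMonoidAlgebra.single (π (Pi.single i (1 : ℤ) - Pi.single j (1 : ℤ))) (1 : ℂ)) q := by
  rw [ratioEval, ← Polynomial.aeval_algHom_apply]
  simp [AddMonoidAlgebra.mapDomainAlgHom, monom]

end Series

/-! ### The three Jacobi terms and the cancellation of factors `x₁ - x₂` -/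

section JacobiIdentity

lemma finsum_eq_sum_range {M : Type*} [AddCommMonoid M] {f : ℕ → M} {K : ℕ} (h : ∀ i, K ≤ i → f i = 0) :
    ∑ᶠ i, f i = ∑ i ∈ range K, f i := by
  refine finsum_eq_sum_of_support_subset _ fun i hi => ?_
  by_contra hn
  exact hi (h i (by simpa using hn))

variable {V W : Type*} [AddCommGroup V] [Module ℂ V] [AddCommGroup W] [Module ℂ W]

lemma exists_coeff_eq_zero (A : VertexOperator ℂ W) (w : W) :
    ∃ N : ℤ, ∀ n < N, HVertexOperator.coeff A n w = 0 :=
  ⟨_, fun n hn => VertexOperator.coeff_eq_zero_of_lt_order A n w hn⟩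

lemma exists_ncoeff_eq_zero (A : VertexOperator ℂ W) (n : ℤ) (w : W) :
    ∃ K : ℕ, ∀ i : ℕ, K ≤ i → VertexOperator.ncoeff A (n + i) w = 0 := by
  obtain ⟨N, hN⟩ := exists_coeff_eq_zero A w
  refine ⟨(-n - N).toNat, fun i hi => ?_⟩
  rw [VertexOperator.ncoeff_apply]
  exact hN _ (by omega)

/-- The expansion of `(x - y)^(n + 1) = x (x - y)^n - y (x - y)^n`. -/
lemma finsum_choose_succ (n : ℤ) {h : ℕ → W} (hh : ∃ K, ∀ i, K ≤ i → h i = 0) :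
    ∑ᶠ i : ℕ, ((-1 : ℂ) ^ i * (Ring.choose (n + 1) i : ℤ)) • h i =
      (∑ᶠ i : ℕ, ((-1 : ℂ) ^ i * (Ring.choose n i : ℤ)) • h i) -
        ∑ᶠ i : ℕ, ((-1 : ℂ) ^ i * (Ring.choose n i : ℤ)) • h (i + 1) := by
  obtain ⟨K, hK⟩ := hh
  rw [finsum_eq_sum_range (K := K + 1) fun i hi => by rw [hK i (by omega), smul_zero],
    finsum_eq_sum_range (K := K + 1) fun i hi => by rw [hK i (by omega), smul_zero],
    finsum_eq_sum_range (K := K) fun i hi => by rw [hK (i + 1) (by omega), smul_zero],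
    Finset.sum_range_succ', Finset.sum_range_succ', add_sub_right_comm,
    ← Finset.sum_sub_distrib]
  congr 1
  · refine Finset.sum_congr rfl fun i _ => ?_
    rw [← sub_smul, Ring.choose_succ_succ]
    congr 1
    push_cast
    ring
  · simp

/-- The Laurent polynomial `x₁ - x₂`. -/
noncomputable def diffPoly : LaurentPoly 2 :=
  monom (Pi.single 0 1) - monom (Pi.single 1 1)

lemma act_diffPoly (F : FormalSeries 2 W) (e : Fin 2 → ℤ) :
    act _ W diffPoly F e = F (e - Pi.single 0 1) - F (e - Pi.single 1 1) := by
  simp [diffPoly, monom, act_single]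

lemma act_diffPoly_jacobiLeft (A B : VertexOperator ℂ W) (n : ℤ) (w : W) :
    act _ W diffPoly (jacobiLeft A B n w) = jacobiLeft A B (n + 1) w := by
  funext e
  obtain ⟨N, hN⟩ := exists_coeff_eq_zero B w
  rw [act_diffPoly]
  simp only [jacobiLeft, Pi.sub_apply, Pi.single_apply]
  rw [finsum_choose_succ]
  · congr 1 <;> refine finsum_congr fun i => ?_ <;> congr 4 <;> simp <;> ring_nf
  · refine ⟨(e 1 - N + 1).toNat, fun i hi => ?_⟩
    rw [hN _ (by omega), map_zero]

lemma act_diffPoly_jacobiMiddle (A B : VertexOperator ℂ W) (n : ℤ) (w : W) :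
    act _ W diffPoly (jacobiMiddle A B n w) = jacobiMiddle A B (n + 1) w := by
  funext e
  obtain ⟨N, hN⟩ := exists_coeff_eq_zero A w
  rw [act_diffPoly]
  simp only [jacobiMiddle, Pi.sub_apply, Pi.single_apply, mul_assoc, mul_smul ((-1 : ℂ) ^ (_ : ℤ)),
    ← smul_finsum]
  -- The expansion is that of `(-1)^n (x₂ - x₁)^n`, so the roles of the two shifts are exchanged and
  -- the extra sign restores `x₁ - x₂`.
  rw [finsum_choose_succ, zpow_add_one₀ (by norm_num), mul_neg_one, neg_smul, smul_sub, neg_sub]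
  · congr 2 <;> refine finsum_congr fun i => ?_ <;> congr 4 <;> simp <;> ring_nf
  · refine ⟨(e 0 - N + 1).toNat, fun i hi => ?_⟩
    rw [hN _ (by omega), map_zero]

/-- Against the delta function `x₁ - x₂` acts as `x₀`, which raises `n` by one. On coefficients this
is Pascal's rule. -/
lemma act_diffPoly_jacobiRight (Y : V →ₗ[ℂ] VertexOperator ℂ V)
    (YW : V →ₗ[ℂ] VertexOperator ℂ W) (u v : V) (n : ℤ) (w : W) :
    act _ W diffPoly (jacobiRight Y YW u v n w) = jacobiRight Y YW u v (n + 1) w := by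
  funext e
  obtain ⟨K, hK⟩ := exists_ncoeff_eq_zero (Y u) n v
  rw [act_diffPoly]
  set c : ℕ → W := fun i => HVertexOperator.coeff
    (YW (VertexOperator.ncoeff (Y u) (n + i) v)) (e 0 + e 1 + i) w with hc
  have hc0 : ∀ i, K ≤ i → c i = 0 := fun i hi => by simp only [hc, hK i hi, map_zero]; rfl
  have h₁ : jacobiRight Y YW u v n w (e - Pi.single 0 1) =
      ∑ᶠ i : ℕ, ((-1 : ℂ) ^ i * (Ring.choose (e 0 - 1 + i) i : ℤ)) • c i := by
    refine finsum_congr fun i => ?_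
    simp only [Pi.sub_apply, Pi.single_apply, hc]
    congr 3
    simp
    ring_nf
  have h₂ : jacobiRight Y YW u v n w (e - Pi.single 1 1) =
      ∑ᶠ i : ℕ, ((-1 : ℂ) ^ i * (Ring.choose (e 0 + i) i : ℤ)) • c i := by
    refine finsum_congr fun i => ?_
    simp only [Pi.sub_apply, Pi.single_apply, hc]
    congr 3 <;> simp
    ring_nf
  have h₃ : jacobiRight Y YW u v (n + 1) w e =
      ∑ᶠ i : ℕ, ((-1 : ℂ) ^ i * (Ring.choose (e 0 + i) i : ℤ)) • c (i + 1) := by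
    refine finsum_congr fun i => ?_
    simp only [hc]
    congr 3
    push_cast; ring_nf
  rw [h₁, h₂, h₃,
    finsum_eq_sum_range (K := K + 1) fun i hi => by rw [hc0 i (by omega), smul_zero],
    finsum_eq_sum_range (K := K + 1) fun i hi => by rw [hc0 i (by omega), smul_zero],
    finsum_eq_sum_range (K := K) fun i hi => by rw [hc0 (i + 1) (by omega), smul_zero],
    ← Finset.sum_sub_distrib, Finset.sum_range_succ']
  -- The `i = 0` terms cancel, which accounts for the index shift in `c (i + 1)`.
  simp only [Ring.choose_zero_right, pow_zero, sub_self, add_zero]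
  refine Finset.sum_congr rfl fun i _ => ?_
  rw [← sub_smul]
  congr 1
  have : Ring.choose (e 0 + ((i + 1 : ℕ) : ℤ)) (i + 1) =
      Ring.choose (e 0 + i) i + Ring.choose (e 0 - 1 + ((i + 1 : ℕ) : ℤ)) (i + 1) := by
    rw [show e 0 + ((i + 1 : ℕ) : ℤ) = e 0 + i + 1 by push_cast; ring,
      show e 0 - 1 + ((i + 1 : ℕ) : ℤ) = e 0 + i by push_cast; ring, Ring.choose_succ_succ]
  rw [this]
  push_cast
  ring

lemma jacobiLeft_zero (A B : VertexOperator ℂ W) (w : W) :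
    jacobiLeft A B 0 w =
      fun e => HVertexOperator.coeff A (e 0) (HVertexOperator.coeff B (e 1) w) := by
  funext e
  rw [jacobiLeft, finsum_eq_single _ 0]
  · simp
  · intro i hi
    rw [Ring.choose_zero_pos ℤ (Nat.pos_of_ne_zero hi)]
    simp

lemma jacobiMiddle_zero (A B : VertexOperator ℂ W) (w : W) :
    jacobiMiddle A B 0 w =
      fun e => HVertexOperator.coeff B (e 1) (HVertexOperator.coeff A (e 0) w) := by
  funext e
  rw [jacobiMiddle, finsum_eq_single _ 0]
  · simp
  · intro i hi
    rw [Ring.choose_zero_pos ℤ (Nat.pos_of_ne_zero hi)]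
    simp

lemma jacobiRight_zero {Y : V →ₗ[ℂ] VertexOperator ℂ V} (YW : V →ₗ[ℂ] VertexOperator ℂ W)
    {u v : V} (h : ∀ n : ℤ, 0 ≤ n → VertexOperator.ncoeff (Y u) n v = 0) (w : W) :
    jacobiRight Y YW u v 0 w = 0 := by
  funext e
  rw [jacobiRight]
  refine finsum_eq_zero_of_forall_eq_zero fun i => ?_
  rw [h _ (by omega), map_zero, map_zero]
  simp

/-- Only `i = 0` survives. The coefficient depends on `e 0 + e 1` alone, so a Laurent polynomial
acts on this series through its value at `x₁ = x₂`. -/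
lemma jacobiRight_neg_one {Y : V →ₗ[ℂ] VertexOperator ℂ V} (YW : V →ₗ[ℂ] VertexOperator ℂ W)
    {u v : V} (h : ∀ n : ℤ, 0 ≤ n → VertexOperator.ncoeff (Y u) n v = 0) (w : W)
    (e : Fin 2 → ℤ) :
    jacobiRight Y YW u v (-1) w e =
      HVertexOperator.coeff (YW (VertexOperator.ncoeff (Y u) (-1) v)) (e 0 + e 1 + 1) w := by
  rw [jacobiRight, finsum_eq_single _ 0]
  · simp only [pow_zero, Nat.cast_zero, add_zero, Ring.choose_zero_right, Int.cast_one, mul_one,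
      one_smul]
    congr 2
    ring_nf
  · intro i hi
    rw [h _ (by omega), map_zero, map_zero]
    simp

/-- This holds for negative `n` too, because `(x₁ - x₂)^n` is expanded in nonnegative powers of
`x₂`. The middle term is bounded in the other variable. -/
lemma boundedBelowAt_jacobiLeft (A B : VertexOperator ℂ W) (n : ℤ) (w : W) :
    BoundedBelowAt 1 (jacobiLeft A B n w) := by
  obtain ⟨N, hN⟩ := exists_coeff_eq_zero B w
  refine ⟨N, fun e he => finsum_eq_zero_of_forall_eq_zero fun i => ?_⟩
  rw [hN _ (by omega), map_zero, smul_zero]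

lemma boundedBelowAt_jacobiMiddle (A B : VertexOperator ℂ W) (n : ℤ) (w : W) :
    BoundedBelowAt 0 (jacobiMiddle A B n w) := by
  obtain ⟨N, hN⟩ := exists_coeff_eq_zero A w
  refine ⟨N, fun e he => finsum_eq_zero_of_forall_eq_zero fun i => ?_⟩
  rw [hN _ (by omega), map_zero, smul_zero]

lemma ofPoly_linear (c : ℂ) :
    ofPoly (MvPolynomial.X 0 - MvPolynomial.C c * MvPolynomial.X 1) =
      monom (Pi.single 1 1) *
        ratioEval (Polynomial.X - Polynomial.C c) (0 : Fin 2) 1 := by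
  have h : (monom (Pi.single 1 1) : LaurentPoly 2) *
      monom (Pi.single 0 1 - Pi.single 1 1) = monom (Pi.single 0 1) := by
    simp [monom, AddMonoidAlgebra.single_mul_single]
  simp only [ofPoly, ratioEval, map_sub, map_mul, MvPolynomial.aeval_X, MvPolynomial.aeval_C,
    Polynomial.aeval_X, Polynomial.aeval_C, mul_sub, h]
  rw [mul_comm (algebraMap _ _ c)]

lemma ofPoly_one_linear :
    ofPoly (MvPolynomial.X 0 - MvPolynomial.C 1 * MvPolynomial.X 1) = diffPoly := by
  simp [ofPoly, diffPoly]

lemma monom_mul {r : ℕ} (k l : Fin r → ℤ) : monom k * monom l = monom (k + l) := by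
  simp [monom, AddMonoidAlgebra.single_mul_single]

/-- Factors with `c = 1` are collected in `diffPoly ^ k`; each other factor contributes a monomial
and `X - c`, which does not vanish at `1`. -/
lemma exists_ofPoly_prod_eq (l : List ℂ) :
    ∃ (k : ℕ) (m : Fin 2 → ℤ) (q : Polynomial ℂ), q.eval 1 ≠ 0 ∧
      ofPoly (l.map fun c => MvPolynomial.X 0 - MvPolynomial.C c * MvPolynomial.X 1).prod =
        monom m * ratioEval q 0 1 * diffPoly ^ k := by
  induction l with
  | nil => 
    refine ⟨0, 0, 1, by simp, ?_⟩
    rw [List.map_nil, List.prod_nil, ofPoly, ratioEval, map_one, map_one, monom,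
      ← AddMonoidAlgebra.one_def, pow_zero, mul_one, mul_one]
  | cons c l ih =>
    obtain ⟨k, m, q, hq, h⟩ := ih
    have hmul : ofPoly ((c :: l).map fun c =>
        MvPolynomial.X 0 - MvPolynomial.C c * MvPolynomial.X 1).prod =
        ofPoly (MvPolynomial.X 0 - MvPolynomial.C c * MvPolynomial.X 1) *
          (monom m * ratioEval q 0 1 * diffPoly ^ k) := by
      rw [← h, List.map_cons, List.prod_cons, ofPoly, map_mul]; rfl
    by_cases hc : c = 1
    · refine ⟨k + 1, m, q, hq, ?_⟩
      rw [hmul, hc, ofPoly_one_linear]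
      ring
    · refine ⟨k, Pi.single 1 1 + m, (Polynomial.X - Polynomial.C c) * q, ?_, ?_⟩
      · simpa [sub_eq_zero, hq] using Ne.symm hc
      · rw [hmul, ofPoly_linear, ← monom_mul, ratioEval, ratioEval, ratioEval, map_mul]
        ring

/-- The Jacobi identity multiplied by a product of linear factors `x₁ - c x₂` implies the one
multiplied by `q(x₁/x₂)` for some `q` with `q(1) = 1`. -/
lemma exists_ratioEval_jacobi {Y : V →ₗ[ℂ] VertexOperator ℂ V}
    {YW : V →ₗ[ℂ] VertexOperator ℂ W} {u v : V} (l : List ℂ)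
    (h : QuasiJacobi Y YW
      (l.map fun c => MvPolynomial.X 0 - MvPolynomial.C c * MvPolynomial.X 1).prod u v) :
    ∃ q : Polynomial ℂ, q.eval 1 = 1 ∧ ∀ (n : ℤ) (w : W),
      act _ W (ratioEval q 0 1) (jacobiLeft (YW u) (YW v) n w) -
        act _ W (ratioEval q 0 1) (jacobiMiddle (YW u) (YW v) n w) =
      act _ W (ratioEval q 0 1) (jacobiRight Y YW u v n w) := by
  obtain ⟨k, m, q, hq, hl⟩ := exists_ofPoly_prod_eq l
  refine ⟨Polynomial.C (q.eval 1)⁻¹ * q, by simp [hq], fun n w => ?_⟩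
  have hpow : ∀ J : ℤ → FormalSeries 2 W, (∀ n, act _ W diffPoly (J n) = J (n + 1)) →
      ∀ (k : ℕ) (n : ℤ), act _ W (diffPoly ^ k) (J (n - k)) = J n := by
    intro J hJ k
    induction k with
    | zero => simp
    | succ k ih =>
      intro n
      rw [pow_succ, map_mul, Module.End.mul_apply, hJ,
        show n - ((k + 1 : ℕ) : ℤ) + 1 = n - k by push_cast; ring, ih]
  -- Starting at `n - k`, the factor `diffPoly ^ k` brings all three terms to component `n`.
  have hJ := h (n - k) w
  simp only [lmul_eq_act, hl, map_mul, Module.End.mul_apply] at hJ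
  rw [hpow _ (fun n => act_diffPoly_jacobiLeft (YW u) (YW v) n w),
    hpow _ (fun n => act_diffPoly_jacobiMiddle (YW u) (YW v) n w),
    hpow _ (fun n => act_diffPoly_jacobiRight Y YW u v n w), ← map_sub] at hJ
  have hJ' := act_single_injective m one_ne_zero hJ
  simp only [ratioEval, map_mul, Polynomial.aeval_C, AlgHom.commutes, Module.End.mul_apply,
    Module.algebraMap_end_apply]
  rw [← smul_sub]
  exact congrArg _ hJ'

end JacobiIdentity

lemma act_map {E M N : Type*} [AddCommGroup E] [AddCommGroup M] [Module ℂ M] [AddCommGroup N]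
    [Module ℂ N] (T : M →ₗ[ℂ] N) (f : AddMonoidAlgebra ℂ E) (F : E → M) (e : E) :
    T (act E M f F e) = act E N f (fun e => T (F e)) e := by
  induction f using AddMonoidAlgebra.induction_linear with
  | zero => simp
  | add f g hf hg => simp only [map_add, LinearMap.add_apply, Pi.add_apply, hf, hg]
  | single k c => simp [act_single]

lemma mapDomainAlgHom_totalDegree_ratioEval {r : ℕ} (q : Polynomial ℂ) (i j : Fin r) :
    AddMonoidAlgebra.mapDomainAlgHom ℂ ℂ (totalDegree r) (ratioEval q i j) =
      algebraMap ℂ _ (q.eval 1) := by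
  have h : totalDegree r (Pi.single i (1 : ℤ) - Pi.single j (1 : ℤ)) = 0 := by
    simp [totalDegree_apply]
  rw [mapDomainAlgHom_ratioEval, h, ← AddMonoidAlgebra.one_def]
  exact Polynomial.aeval_algebraMap_apply_eq_algebraMap_eval (1 : ℂ) q

/-! ### Regularized products of vertex operators: commutation, truncation, diagonal values -/

section OperatorProducts

variable {V W : Type*} [AddCommGroup V] [Module ℂ V] [AddCommGroup W] [Module ℂ W]

section RegularizedJacobi

variable {Y : V →ₗ[ℂ] VertexOperator ℂ V} {YW : V →ₗ[ℂ] VertexOperator ℂ W} {u v : V}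
  {q : Polynomial ℂ}

lemma act_ratioEval_comm
    (h : ∀ n : ℤ, 0 ≤ n → VertexOperator.ncoeff (Y u) n v = 0)
    (hJ : ∀ (n : ℤ) (w : W),
      act _ W (ratioEval q 0 1) (jacobiLeft (YW u) (YW v) n w) -
        act _ W (ratioEval q 0 1) (jacobiMiddle (YW u) (YW v) n w) =
      act _ W (ratioEval q 0 1) (jacobiRight Y YW u v n w)) (w : W) :
    act (Fin 2 → ℤ) W (ratioEval q 0 1)
        (fun e => HVertexOperator.coeff (YW u) (e 0) (HVertexOperator.coeff (YW v) (e 1) w)) =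
      act (Fin 2 → ℤ) W (ratioEval q 0 1)
        (fun e => HVertexOperator.coeff (YW v) (e 1) (HVertexOperator.coeff (YW u) (e 0) w)) := by
  rw [← jacobiLeft_zero, ← jacobiMiddle_zero, ← sub_eq_zero, hJ, jacobiRight_zero YW h, map_zero]

/-- If `u_n v = 0` for `n ≥ 0`, then `q(x₁/x₂) Y_W(u, x₁) Y_W(v, x₂)` lies in
`Hom(W, W((x₁, x₂)))`. -/
lemma boundedBelowAt_act_ratioEval
    (h : ∀ n : ℤ, 0 ≤ n → VertexOperator.ncoeff (Y u) n v = 0)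
    (hJ : ∀ (n : ℤ) (w : W),
      act _ W (ratioEval q 0 1) (jacobiLeft (YW u) (YW v) n w) -
        act _ W (ratioEval q 0 1) (jacobiMiddle (YW u) (YW v) n w) =
      act _ W (ratioEval q 0 1) (jacobiRight Y YW u v n w)) (w : W) (i : Fin 2) :
    BoundedBelowAt i (act (Fin 2 → ℤ) W (ratioEval q 0 1)
      (fun e =>
        HVertexOperator.coeff (YW u) (e 0) (HVertexOperator.coeff (YW v) (e 1) w))) := by
  fin_cases i
  · rw [act_ratioEval_comm h hJ, ← jacobiMiddle_zero]
    exact (boundedBelowAt_jacobiMiddle _ _ _ _).act _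
  · rw [← jacobiLeft_zero]
    exact (boundedBelowAt_jacobiLeft _ _ _ _).act _

/-- If `u_n v = 0` for `n ≥ 0`, then `Y_W(u_{-1} v, x)` is obtained from
`q(x₁/x₂) Y_W(u, x₁) Y_W(v, x₂)` by setting `x₁ = x₂ = x`. -/
lemma substAlong_act_ratioEval (hq : q.eval 1 = 1)
    (h : ∀ n : ℤ, 0 ≤ n → VertexOperator.ncoeff (Y u) n v = 0)
    (hJ : ∀ (n : ℤ) (w : W),
      act _ W (ratioEval q 0 1) (jacobiLeft (YW u) (YW v) n w) -
        act _ W (ratioEval q 0 1) (jacobiMiddle (YW u) (YW v) n w) =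
      act _ W (ratioEval q 0 1) (jacobiRight Y YW u v n w)) (w : W) :
    substAlong (totalDegree 2) (act (Fin 2 → ℤ) W (ratioEval q 0 1)
      (fun e => HVertexOperator.coeff (YW u) (e 0) (HVertexOperator.coeff (YW v) (e 1) w))) =
      fun m => HVertexOperator.coeff (YW (VertexOperator.ncoeff (Y u) (-1) v)) m w := by
  funext m
  set C : ℤ → W := fun m =>
    HVertexOperator.coeff (YW (VertexOperator.ncoeff (Y u) (-1) v)) m w with hC
  set L := act _ W (ratioEval q 0 1) (jacobiLeft (YW u) (YW v) (-1) w) with hL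
  obtain ⟨N₁, hN₁⟩ : BoundedBelowAt 1 L := (boundedBelowAt_jacobiLeft _ _ _ _).act _
  obtain ⟨N₀, hN₀⟩ : BoundedBelowAt 0 (act _ W (ratioEval q 0 1)
    (jacobiMiddle (YW u) (YW v) (-1) w)) := (boundedBelowAt_jacobiMiddle _ _ _ _).act _
  -- The right side is constant on each total degree, so `q` acts on it as `q.eval 1 = 1`.
  have hR : ∀ e, act _ W (ratioEval q 0 1) (jacobiRight Y YW u v (-1) w) e =
      C (e 0 + e 1 + 1) := by
    intro e
    have := act_natural (totalDegree 2) LinearMap.id (fun _ => e) (ratioEval q 0 1)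
      (jacobiRight Y YW u v (-1) w) (fun m => C (m + 1)) (e 0 + e 1) (fun k => by
        rw [LinearMap.id_apply, jacobiRight_neg_one YW h, totalDegree_apply, Fin.sum_univ_two, hC]
        simp only [Pi.sub_apply]
        congr 2
        ring_nf)
    rw [mapDomainAlgHom_totalDegree_ratioEval, hq, map_one, map_one] at this
    exact this.symm
  -- For small exponents of `x₁` the middle term vanishes and the identity determines `L`.
  have hLC : ∀ e, e 0 < N₀ → L e = C (e 0 + e 1 + 1) := by
    intro e he
    rw [← hR, ← hJ, Pi.sub_apply, hN₀ e he, sub_zero]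
  -- The product itself is component `0`, hence `x₁ - x₂` times component `-1`; along an
  -- antidiagonal it is a sequence of differences of `L`.
  rw [← jacobiLeft_zero, show (0 : ℤ) = -1 + 1 by norm_num, ← act_diffPoly_jacobiLeft,
    ← Module.End.mul_apply, ← map_mul, mul_comm, map_mul, Module.End.mul_apply, ← hL]
  have hG : ∀ e : Fin 2 → ℤ, e 0 + e 1 = m →
      act _ W diffPoly L e = L ![e 0 - 1, m - 1 - (e 0 - 1)] - L ![e 0, m - 1 - e 0] := by
    intro e he
    rw [act_diffPoly]
    congr 2 <;> funext i <;> fin_cases i <;> simp <;> linarith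
  -- After `K` steps from `N₀` the exponent of `x₂` is below `N₁`, where `L` vanishes. The
  -- telescoping sum thus reduces to its initial term, which is `C m` by `hLC`.
  set K := (m - N₀ - N₁ + 1).toNat with hK
  rw [substAlong_eq_sum (s := (range K).image fun i : ℕ => ![N₀ + i, m - (N₀ + i)]),
    Finset.sum_image]
  · have : ∀ i ∈ range K, act _ W diffPoly L ![N₀ + (i : ℤ), m - (N₀ + i)] =
        L ![N₀ - 1 + i, m - 1 - (N₀ - 1 + i)] -
          L ![N₀ - 1 + (i + 1 : ℕ), m - 1 - (N₀ - 1 + (i + 1 : ℕ))] := by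
      intro i _
      rw [hG _ (by simp), show N₀ - 1 + (i : ℤ) = N₀ + i - 1 by ring,
        show N₀ - 1 + ((i + 1 : ℕ) : ℤ) = N₀ + i by push_cast; ring]
      rfl
    rw [Finset.sum_congr rfl this,
      Finset.sum_range_sub' (fun i : ℕ => L ![N₀ - 1 + (i : ℤ), m - 1 - (N₀ - 1 + i)]),
      hLC _ (by simp), hN₁ _ (by simp; omega)]
    simp [hC]
  · intro i _ j _ hij
    have := congrFun hij 0
    simpa using this
  · intro e he
    obtain ⟨i, -, rfl⟩ := Finset.mem_image.1 he
    simp [totalDegree_apply]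
  · intro e he hne
    rw [totalDegree_apply, Fin.sum_univ_two] at he
    rw [hG e he] at hne
    -- To the left of the range both values of `L` equal `C m` and cancel; to the right both are
    -- zero.
    have h₀ : N₀ ≤ e 0 := by
      by_contra hlt
      refine hne ?_
      rw [hLC _ (by simp; omega), hLC _ (by simp; omega), sub_eq_zero]
      simp
    have h₁ : e 0 < N₀ + K := by
      by_contra hlt
      refine hne ?_
      rw [hN₁ _ (by simp; omega), hN₁ _ (by simp; omega), sub_zero]
    refine Finset.mem_image.2 ⟨(e 0 - N₀).toNat, by simp; omega, ?_⟩
    funext i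
    fin_cases i <;> simp <;> omega

end RegularizedJacobi

/-- The inclusion of the exponents of the variables other than the first. -/
def consZero (r : ℕ) : (Fin r → ℤ) →+ (Fin (r + 1) → ℤ) where
  toFun k := Fin.cons 0 k
  map_zero' := by funext i; cases i using Fin.cases <;> simp
  map_add' k l := by funext i; cases i using Fin.cases <;> simp

lemma consZero_single {r : ℕ} (i : Fin r) :
    consZero r (Pi.single i 1) = Pi.single i.succ 1 := by
  funext j
  cases j using Fin.cases with
  | zero => simp [consZero]
  | succ j => simp [consZero, Pi.single_apply]

/-- `∏_{i < j} q(x_i / x_j)`. -/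
noncomputable def ratioProd (q : Polynomial ℂ) (r : ℕ) : LaurentPoly r :=
  ∏ i : Fin r, ∏ j ∈ Ioi i, ratioEval q i j

lemma ratioProd_succ (q : Polynomial ℂ) (r : ℕ) :
    ratioProd q (r + 1) = (∏ j : Fin r, ratioEval q 0 j.succ) *
      AddMonoidAlgebra.mapDomainAlgHom ℂ ℂ (consZero r) (ratioProd q r) := by
  simp only [ratioProd, Fin.prod_univ_succ, Fin.prod_Ioi_zero, Fin.prod_Ioi_succ, map_prod,
    mapDomainAlgHom_ratioEval, map_sub, consZero_single]
  rfl

lemma regularizedProduct_eq_act (q : Polynomial ℂ) (r : ℕ) (A : VertexOperator ℂ W) :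
    regularizedProduct q r A = act _ _ (ratioProd q r) (powerProduct r A) :=
  lmul_eq_act _ _

lemma powerProduct_succ (r : ℕ) (A : VertexOperator ℂ W) (e : Fin (r + 1) → ℤ) :
    powerProduct (r + 1) A e =
      HVertexOperator.coeff A (e 0) * powerProduct r A (fun i => e i.succ) := by
  simp only [powerProduct, List.ofFn_succ, List.prod_cons]

/-- This recursion drives the inductions on `r`: the factors not involving the first variable pass
through `A(x₀)`. -/
lemma regularizedProduct_succ (q : Polynomial ℂ) (r : ℕ) (A : VertexOperator ℂ W) :
    regularizedProduct q (r + 1) A = act _ _ (∏ j : Fin r, ratioEval q 0 j.succ)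
      (fun e => HVertexOperator.coeff A (e 0) * regularizedProduct q r A (fun i => e i.succ)) := by
  rw [regularizedProduct_eq_act, ratioProd_succ, map_mul, Module.End.mul_apply]
  congr 1
  funext e
  rw [regularizedProduct_eq_act]
  refine act_natural (consZero r) (LinearMap.mulLeft ℂ (HVertexOperator.coeff A (e 0)))
    (fun e i => e i.succ) (ratioProd q r) (powerProduct r A) (powerProduct (r + 1) A) e
    fun k => ?_
  rw [powerProduct_succ]
  simp [consZero, Pi.sub_def]

lemma take_ofFn_congr {α : Type*} {r k : ℕ} {f g : Fin r → α} (h : ∀ i : Fin r, i < k → f i = g i) :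
    (List.ofFn f).take k = (List.ofFn g).take k := by
  refine List.ext_getElem (by simp) fun i h₁ h₂ => ?_
  simp only [List.length_take, List.length_ofFn, lt_min_iff] at h₁
  simpa using h ⟨i, h₁.2⟩ h₁.1

lemma drop_ofFn_congr {α : Type*} {r k : ℕ} {f g : Fin r → α} (h : ∀ i : Fin r, k ≤ i → f i = g i) :
    (List.ofFn f).drop k = (List.ofFn g).drop k := by
  refine List.ext_getElem (by simp) fun i h₁ h₂ => ?_
  simp only [List.length_drop, List.length_ofFn] at h₁
  simpa using h ⟨k + i, by omega⟩ (by simp)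

/-- The product `A(x₁) ⋯ A(x_k) A(x₀) A(x_{k+1}) ⋯ A(x_r)`. -/
noncomputable def insertedProduct (r k : ℕ) (A : VertexOperator ℂ W) :
    FormalSeries (r + 1) (Module.End ℂ W) := fun e =>
  ((List.ofFn fun i : Fin r => HVertexOperator.coeff A (e i.succ)).take k).prod *
    (HVertexOperator.coeff A (e 0) *
      ((List.ofFn fun i : Fin r => HVertexOperator.coeff A (e i.succ)).drop k).prod)

/-- The inclusion of the exponents of the first and of another variable. -/
def pairEmb {r : ℕ} (j : Fin r) : (Fin 2 → ℤ) →+ (Fin (r + 1) → ℤ) where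
  toFun k := Fin.cons (k 0) (Pi.single j (k 1))
  map_zero' := by funext i; cases i using Fin.cases <;> simp
  map_add' k l := by funext i; cases i using Fin.cases <;> simp [Pi.single_add]

lemma mapDomainAlgHom_pairEmb_ratioEval {r : ℕ} (j : Fin r) (q : Polynomial ℂ) :
    AddMonoidAlgebra.mapDomainAlgHom ℂ ℂ (pairEmb j) (ratioEval q 0 1) =
      ratioEval q 0 j.succ := by
  rw [mapDomainAlgHom_ratioEval, map_sub]
  have h₀ : pairEmb j (Pi.single 0 1) = Pi.single 0 1 := by
    funext i
    cases i using Fin.cases <;> simp [pairEmb]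
  have h₁ : pairEmb j (Pi.single 1 1) = Pi.single j.succ 1 := by
    funext i
    cases i using Fin.cases <;> simp [pairEmb, Pi.single_apply]
  rw [h₀, h₁]
  rfl

/-- `A(x₀)` moves past one neighbour. The operators on either side do not involve the two variables
concerned, so `act_natural` transports the two-variable identity. -/
lemma act_ratioEval_insertedProduct_succ {q : Polynomial ℂ} {A : VertexOperator ℂ W}
    (hA : SelfCommutesAfter q A) {r : ℕ} (j : Fin r) :
    act _ _ (ratioEval q 0 j.succ) (insertedProduct r j A) =
      act _ _ (ratioEval q 0 j.succ) (insertedProduct r (j + 1) A) := by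
  funext e
  rw [SelfCommutesAfter, lmul_eq_act, lmul_eq_act] at hA
  set X := ((List.ofFn fun i : Fin r => HVertexOperator.coeff A (e i.succ)).take j).prod
  set Z := ((List.ofFn fun i : Fin r => HVertexOperator.coeff A (e i.succ)).drop (j + 1)).prod
  set T : Module.End ℂ W →ₗ[ℂ] Module.End ℂ W :=
    (LinearMap.mulLeft ℂ X).comp (LinearMap.mulRight ℂ Z) with hT
  have hX : ∀ k, ((List.ofFn fun i : Fin r =>
      HVertexOperator.coeff A ((e - pairEmb j k) i.succ)).take j).prod = X := fun k =>
    congrArg List.prod <| take_ofFn_congr fun i hi => by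
      simp [pairEmb, Pi.single_eq_of_ne (Fin.ne_of_lt hi)]
  have hZ : ∀ k, ((List.ofFn fun i : Fin r =>
      HVertexOperator.coeff A ((e - pairEmb j k) i.succ)).drop (j + 1)).prod = Z := fun k =>
    congrArg List.prod <| drop_ofFn_congr fun i hi => by
      simp [pairEmb, Pi.single_eq_of_ne (Fin.ne_of_gt (Nat.lt_of_succ_le hi))]
  have h₁ := act_natural (pairEmb j) T (fun e => ![e 0, e j.succ]) (ratioEval q 0 1)
    (fun e => HVertexOperator.coeff A (e 0) * HVertexOperator.coeff A (e 1))
    (insertedProduct r j A) e fun k => by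
      rw [insertedProduct, hX, List.drop_eq_getElem_cons (by simp), List.prod_cons, hZ]
      simp [hT, pairEmb, mul_assoc]
  have h₂ := act_natural (pairEmb j) T (fun e => ![e 0, e j.succ]) (ratioEval q 0 1)
    (fun e => HVertexOperator.coeff A (e 1) * HVertexOperator.coeff A (e 0))
    (insertedProduct r (j + 1) A) e fun k => by
      rw [insertedProduct, hZ, List.take_succ_eq_append_getElem (by simp), List.prod_append, hX]
      simp [hT, pairEmb, mul_assoc]
  rw [mapDomainAlgHom_pairEmb_ratioEval] at h₁ h₂
  rw [h₁, h₂, hA]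

/-- `∏_j q(x₀/x_j) A(x₀) A(x₁) ⋯ A(x_r) = ∏_j q(x₀/x_j) A(x₁) ⋯ A(x_r) A(x₀)`. -/
lemma act_prod_ratioEval_powerProduct {q : Polynomial ℂ} {A : VertexOperator ℂ W}
    (hA : SelfCommutesAfter q A) (r : ℕ) :
    act _ _ (∏ j : Fin r, ratioEval q 0 j.succ) (powerProduct (r + 1) A) =
      act _ _ (∏ j : Fin r, ratioEval q 0 j.succ)
        (fun e => powerProduct r A (fun i => e i.succ) * HVertexOperator.coeff A (e 0)) := by
  have key : ∀ k ≤ r, act _ _ (∏ j : Fin r, ratioEval q 0 j.succ) (insertedProduct r 0 A) =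
      act _ _ (∏ j : Fin r, ratioEval q 0 j.succ) (insertedProduct r k A) := by
    intro k
    induction k with
    | zero => intro _; rfl
    | succ k ih =>
      intro hk
      -- The factor belonging to the neighbour being crossed is split off.
      rw [ih (by omega), ← Finset.mul_prod_erase _ _ (Finset.mem_univ (⟨k, hk⟩ : Fin r)), mul_comm,
        map_mul, Module.End.mul_apply, Module.End.mul_apply]
      exact congrArg _ (act_ratioEval_insertedProduct_succ hA ⟨k, hk⟩)
  convert key r le_rfl using 2
  · funext e
    simp [insertedProduct, powerProduct]
  · funext e
    rw [insertedProduct, List.take_of_length_le (by simp), List.drop_eq_nil_of_le (by simp),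
      List.prod_nil, mul_one]
    rfl

/-- For the first variable, `A(x₀)` is moved to the far right, where it acts directly on `w`. For
the others the bound comes from the induction hypothesis, which applying `A(x₀)` and multiplying by
a Laurent polynomial preserve. -/
lemma boundedBelowAt_regularizedProduct {q : Polynomial ℂ} {A : VertexOperator ℂ W}
    (hA : SelfCommutesAfter q A) (r : ℕ) (w : W) (i : Fin r) :
    BoundedBelowAt i fun e => regularizedProduct q r A e w := by
  induction r with
  | zero => exact i.elim0
  | succ r ih =>
    cases i using Fin.cases with
    | zero =>
      have h : (fun e => regularizedProduct q (r + 1) A e w) =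
          act _ _ (ratioProd q (r + 1)) (fun e : Fin (r + 1) → ℤ =>
            (powerProduct r A (fun i => e i.succ) * HVertexOperator.coeff A (e 0)) w) := by
        rw [regularizedProduct_eq_act, ratioProd_succ, mul_comm, map_mul, Module.End.mul_apply,
          act_prod_ratioEval_powerProduct hA, ← Module.End.mul_apply, ← map_mul]
        funext e
        exact act_map (LinearMap.applyₗ w) _ _ e
      rw [h]
      obtain ⟨N, hN⟩ := exists_coeff_eq_zero A w
      refine BoundedBelowAt.act _ ⟨N, fun e he => ?_⟩
      simp only [Module.End.mul_apply, hN _ he, map_zero]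
    | succ i =>
      have h : (fun e => regularizedProduct q (r + 1) A e w) =
          act _ _ (∏ j : Fin r, ratioEval q 0 j.succ) (fun e : Fin (r + 1) → ℤ =>
            HVertexOperator.coeff A (e 0) (regularizedProduct q r A (fun i => e i.succ) w)) := by
        rw [regularizedProduct_succ]
        funext e
        exact act_map (LinearMap.applyₗ w) _ _ e
      rw [h]
      obtain ⟨N, hN⟩ := ih i
      refine BoundedBelowAt.act _ ⟨N, fun e he => ?_⟩
      have h₀ : regularizedProduct q r A (fun i => e i.succ) w = 0 := hN (fun i => e i.succ) he
      simp only [h₀, map_zero]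

/-- The exponents after the substitution `x₁ = ⋯ = x_r`, the variable `x₀` being kept. -/
def partialDegree (r : ℕ) : (Fin (r + 1) → ℤ) →+ (Fin 2 → ℤ) where
  toFun e := ![e 0, ∑ i : Fin r, e i.succ]
  map_zero' := by funext i; fin_cases i <;> simp
  map_add' k l := by funext i; fin_cases i <;> simp [Finset.sum_add_distrib]

lemma totalDegree_comp_partialDegree (r : ℕ) :
    (totalDegree 2).comp (partialDegree r) = totalDegree (r + 1) := by
  refine AddMonoidHom.ext fun e => ?_
  simp [totalDegree_apply, partialDegree, Fin.sum_univ_succ]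

lemma mapDomainAlgHom_partialDegree_prod (q : Polynomial ℂ) (r : ℕ) :
    AddMonoidAlgebra.mapDomainAlgHom ℂ ℂ (partialDegree r)
      (∏ j : Fin r, ratioEval q 0 j.succ) = ratioEval q 0 1 ^ r := by
  have h : ∀ j : Fin r, partialDegree r (Pi.single 0 1 - Pi.single j.succ 1) =
      Pi.single 0 1 - Pi.single 1 1 := by
    intro j
    funext i
    fin_cases i <;> simp [partialDegree, Pi.single_apply]
  simp only [map_prod, mapDomainAlgHom_ratioEval, h]
  simp [ratioEval, monom]

lemma diagCoeff_eq_substAlong {r : ℕ} (F : FormalSeries r (Module.End ℂ W)) (m : ℤ) (w : W) :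
    diagCoeff F m w = substAlong (totalDegree r) (fun e => F e w) m := rfl

/-- If `B(x)` is the value of `F` at `x₁ = ⋯ = x_r = x`, then substituting `x₁ = ⋯ = x_r = x₂` in
`∏_j q(x₀/x_j) A(x₀) F` gives `q(x₀/x₂)^r A(x₀) B(x₂)`. -/
lemma substAlong_partialDegree {q : Polynomial ℂ} {A : VertexOperator ℂ W}
    (hA : SelfCommutesAfter q A) {r : ℕ} {B : VertexOperator ℂ W} (w : W)
    (hB : ∀ m, HVertexOperator.coeff B m w = diagCoeff (regularizedProduct q r A) m w) :
    substAlong (partialDegree r) (fun e => regularizedProduct q (r + 1) A e w) =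
      act _ W (ratioEval q 0 1 ^ r) (fun e => HVertexOperator.coeff A (e 0)
        (HVertexOperator.coeff B (e 1) w)) := by
  classical
  have hs := summableAlong_totalDegree (boundedBelowAt_regularizedProduct hA r w)
  set H : FormalSeries (r + 1) W := fun e =>
    HVertexOperator.coeff A (e 0) (regularizedProduct q r A (fun i => e i.succ) w) with hH
  have h : (fun e => regularizedProduct q (r + 1) A e w) =
      act _ _ (∏ j : Fin r, ratioEval q 0 j.succ) H := by
    rw [regularizedProduct_succ]
    funext e
    exact act_map (LinearMap.applyₗ w) _ _ e
  -- In the fibre over `y` the first exponent is `y 0` and the others have total `y 1`; truncation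
  -- of the shorter product leaves finitely many.
  have hfib : ∀ y, ∀ e, partialDegree r e = y → H e ≠ 0 →
      e ∈ (hs (y 1)).toFinset.image (fun k => (Fin.cons (y 0) k : Fin (r + 1) → ℤ)) := by
    intro y e he hne
    refine Finset.mem_image.2 ⟨fun i => e i.succ, (hs _).mem_toFinset.2 ⟨?_, fun h0 => ?_⟩, ?_⟩
    · simp [← he, totalDegree_apply, partialDegree]
    · exact hne (by simp only [hH, h0, map_zero])
    · rw [← he]
      exact Fin.cons_self_tail e
  have hH' : SummableAlong (partialDegree r) H := fun y =>
    (Finset.finite_toSet _).subset fun e he => hfib y e he.1 he.2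
  rw [h, substAlong_act _ hH', mapDomainAlgHom_partialDegree_prod]
  congr 1
  funext y
  rw [substAlong_eq_sum _ (hfib y), Finset.sum_image (Fin.cons_right_injective _).injOn, hB,
    diagCoeff_eq_substAlong, substAlong_eq_sum (s := (hs (y 1)).toFinset), map_sum]
  · simp [hH]
  · intro k hk
    exact ((hs _).mem_toFinset.1 hk).1
  · intro k h₁ h₂
    exact (hs _).mem_toFinset.2 ⟨h₁, h₂⟩
  · intro e he
    obtain ⟨k, hk, rfl⟩ := Finset.mem_image.1 he
    have := ((hs _).mem_toFinset.1 hk).1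
    funext i
    fin_cases i
    · simp [partialDegree]
    · simpa [partialDegree, totalDegree_apply] using this

end OperatorProducts

/-! ### Powers of `a_{-1}` on the vacuum and their vertex operators -/

section EquivariantModules

variable {Γ V W : Type*} [Group Γ] [AddCommGroup V] [Module ℂ V] [AddCommGroup W] [Module ℂ W]

lemma EquivariantQuasiModule.exists_ratioEval_jacobi {A : VertexGroupAlgebra Γ V}
    (M : EquivariantQuasiModule A W) (u v : V) :
    ∃ q : Polynomial ℂ, q.eval 1 = 1 ∧ ∀ (n : ℤ) (w : W),
      act _ W (ratioEval q 0 1) (jacobiLeft (M.Y u) (M.Y v) n w) -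
        act _ W (ratioEval q 0 1) (jacobiMiddle (M.Y u) (M.Y v) n w) =
      act _ W (ratioEval q 0 1) (jacobiRight A.Y M.Y u v n w) := by
  obtain ⟨l, hl⟩ := M.equivariant_jacobi u v
  refine VertexTheory.exists_ratioEval_jacobi (l.map fun g => (A.φ g : ℂ)) ?_
  rw [List.map_map]
  exact hl

lemma EquivariantQuasiModule.exists_selfCommutesAfter {A : VertexGroupAlgebra Γ V}
    (M : EquivariantQuasiModule A W) {a : V} (ha : ∀ n : ℤ, 0 ≤ n → A.mode a n a = 0) :
    ∃ q : Polynomial ℂ, q.eval 1 = 1 ∧ SelfCommutesAfter q (M.Y a) := by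
  obtain ⟨q, hq, hJ⟩ := M.exists_ratioEval_jacobi a a
  refine ⟨q, hq, ?_⟩
  rw [SelfCommutesAfter, lmul_eq_act, lmul_eq_act]
  funext e
  refine LinearMap.ext fun w => ?_
  exact (act_map (LinearMap.applyₗ w) _ _ e).trans <|
    (congrFun (act_ratioEval_comm ha hJ w) e).trans
      (act_map (LinearMap.applyₗ w) _ (fun e : Fin 2 → ℤ =>
        HVertexOperator.coeff (M.Y a) (e 1) * HVertexOperator.coeff (M.Y a) (e 0)) e).symm

lemma VertexAlgebra.mode_commute (A : VertexAlgebra V) {a : V}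
    (ha : ∀ n : ℤ, 0 ≤ n → A.mode a n a = 0) (m n : ℤ) : Commute (A.mode a m) (A.mode a n) := by
  refine LinearMap.ext fun w => ?_
  have h := A.jacobi a a 0 w
  have hone : ofPoly 1 = 1 := by rw [ofPoly, map_one]
  rw [jacobiRight_zero A.Y ha, hone] at h
  simp only [lmul_eq_act, map_one, Module.End.one_apply, jacobiLeft_zero, jacobiMiddle_zero] at h
  have := congrFun h ![-m - 1, -n - 1]
  simpa [sub_eq_zero, VertexAlgebra.mode] using this

/-- The mode `a_n` commutes with `a_{-1}` and annihilates the vacuum. This makes the two-operator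
results applicable to `a` and `(a_{-1})^r 𝟏`. -/
lemma VertexAlgebra.mode_pow_vac (A : VertexAlgebra V) {a : V}
    (ha : ∀ n : ℤ, 0 ≤ n → A.mode a n a = 0) (r : ℕ) (n : ℤ) (hn : 0 ≤ n) :
    A.mode a n ((A.mode a (-1) ^ r) A.vac) = 0 := by
  rw [← Module.End.mul_apply, ((A.mode_commute ha n (-1)).pow_right r).eq, Module.End.mul_apply]
  have : A.mode a n A.vac = 0 := by
    rw [VertexAlgebra.mode, VertexOperator.ncoeff_apply]
    exact A.creation_neg a _ (by omega)
  rw [this, map_zero]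

/-- `Y_W((a_{-1})^r 𝟏, x)` is the value at `x₁ = ⋯ = x_r = x` of the regularized product. -/
theorem EquivariantQuasiModule.coeff_pow_vac {A : VertexGroupAlgebra Γ V}
    (M : EquivariantQuasiModule A W) {a : V} (ha : ∀ n : ℤ, 0 ≤ n → A.mode a n a = 0)
    {q : Polynomial ℂ} (hq : q.eval 1 = 1) (hc : SelfCommutesAfter q (M.Y a)) (r : ℕ)
    (m : ℤ) (w : W) :
    HVertexOperator.coeff (M.Y ((A.mode a (-1) ^ r) A.vac)) m w =
      diagCoeff (regularizedProduct q r (M.Y a)) m w := by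
  induction r generalizing m with
  | zero =>
    rw [pow_zero, Module.End.one_apply, M.vacuum, diagCoeff_eq_substAlong,
      regularizedProduct_eq_act]
    have h : ∀ e, act (Fin 0 → ℤ) _ (ratioProd q 0) (powerProduct 0 (M.Y a)) e = 1 := by
      intro e
      simp [ratioProd, powerProduct]
    simp only [h, Module.End.one_apply]
    -- There is a single exponent, the empty one, of degree `0`; the empty product is the identity.
    split_ifs with hm
    · rw [substAlong_eq_sum (s := {0})]
      · simp
      · simp [hm, totalDegree_apply]
      · intro e _ _
        simp [Subsingleton.elim e 0]
    · rw [substAlong_eq_sum (s := ∅)]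
      · simp
      · simp
      · intro e he _
        exact absurd (he.symm.trans (by simp [totalDegree_apply])) hm
  | succ r ih =>
    set b := (A.mode a (-1) ^ r) A.vac with hb
    have hab := A.mode_pow_vac ha r
    obtain ⟨p, hp, hJ⟩ := M.exists_ratioEval_jacobi a b
    set AB : FormalSeries 2 W := fun e =>
      HVertexOperator.coeff (M.Y a) (e 0) (HVertexOperator.coeff (M.Y b) (e 1) w) with hAB
    have hsum := summableAlong_totalDegree
      (boundedBelowAt_regularizedProduct hc (r + 1) w)
    rw [← totalDegree_comp_partialDegree] at hsum
    -- Summability of `AB` itself along the diagonal is not available; it is established for `q^r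
    -- AB` here and for `p AB` in `hG'`.
    have hG := hsum.substAlong
    rw [substAlong_partialDegree hc w ih, ← hAB] at hG
    have hG' := summableAlong_totalDegree (boundedBelowAt_act_ratioEval hab hJ w)
    -- The diagonal value of `p q^r AB` is computed in two ways: dropping `p` leaves the regularized
    -- product, dropping `q^r` leaves `Y_W(a_{-1} b, x)`.
    have key := congrArg (substAlong (totalDegree 2)) (show
      act _ W (ratioEval p 0 1) (act _ W (ratioEval q 0 1 ^ r) AB) =
        act _ W (ratioEval q 0 1 ^ r) (act _ W (ratioEval p 0 1) AB) by
      rw [← Module.End.mul_apply, ← map_mul, mul_comm, map_mul, Module.End.mul_apply])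
    have hqr : AddMonoidAlgebra.mapDomainAlgHom ℂ ℂ (totalDegree 2) (ratioEval q 0 1 ^ r) = 1 := by
      rw [map_pow, mapDomainAlgHom_totalDegree_ratioEval, hq, map_one, one_pow]
    rw [substAlong_act _ hG, substAlong_act _ hG', hqr, mapDomainAlgHom_totalDegree_ratioEval, hp,
      map_one, map_one, Module.End.one_apply, Module.End.one_apply,
      substAlong_act_ratioEval hp hab hJ, ← substAlong_partialDegree hc w ih,
      substAlong_substAlong hsum, totalDegree_comp_partialDegree] at key
    rw [diagCoeff_eq_substAlong, key, pow_succ', Module.End.mul_apply]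
    rfl

end EquivariantModules

end VertexTheory

theorem proposition5p2 {Γ : Type*} [Group Γ] {V : Type*} [AddCommGroup V] [Module ℂ V]
    (A : VertexTheory.VertexGroupAlgebra Γ V) (a : V)
    (ha : ∀ n : ℤ, 0 ≤ n → A.mode a n a = 0)
    {W : Type*} [AddCommGroup W] [Module ℂ W]
    (M : VertexTheory.EquivariantQuasiModule A W) :
    (∃ q : Polynomial ℂ, q.eval 1 = 1 ∧ VertexTheory.SelfCommutesAfter q (M.Y a)) ∧
    ∀ q : Polynomial ℂ, q.eval 1 = 1 → VertexTheory.SelfCommutesAfter q (M.Y a) →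
      ∀ ℓ : ℕ, 0 < ℓ →
        VertexTheory.IsLowerTruncated (VertexTheory.regularizedProduct q (ℓ + 1) (M.Y a)) ∧
        (∀ (m : ℤ) (w : W),
          HVertexOperator.coeff (M.Y ((A.mode a (-1) ^ (ℓ + 1)) A.vac)) m w =
            VertexTheory.diagCoeff (VertexTheory.regularizedProduct q (ℓ + 1) (M.Y a)) m w) ∧
        ((A.mode a (-1) ^ (ℓ + 1)) A.vac = 0 → ∀ (m : ℤ) (w : W),
          VertexTheory.diagCoeff (VertexTheory.regularizedProduct q (ℓ + 1) (M.Y a)) m w = 0) ∧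
        (Function.Injective M.Y →
          (∀ (m : ℤ) (w : W),
            VertexTheory.diagCoeff (VertexTheory.regularizedProduct q (ℓ + 1) (M.Y a)) m w = 0) →
          (A.mode a (-1) ^ (ℓ + 1)) A.vac = 0) := by
  refine ⟨M.exists_selfCommutesAfter ha, fun q hq hc ℓ _ => ?_⟩
  have hpow := M.coeff_pow_vac ha hq hc (ℓ + 1)
  refine ⟨fun w => VertexTheory.exists_common_lower_bound
    (VertexTheory.boundedBelowAt_regularizedProduct hc (ℓ + 1) w), hpow, fun h m w => ?_,
    fun hinj h => hinj ?_⟩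
  · rw [← hpow, h, map_zero, map_zero]
    rfl
  · refine HVertexOperator.coeff_inj (funext fun m => LinearMap.ext fun w => ?_)
    rw [hpow, h, map_zero, map_zero]
    rfl
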